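/- Let $T$ be an infinite, locally finite tree. For a locally finite connected graph $G$ write $m(x)$ for the valence of a vertex $x$ and $\Delta f(x)=\sum_{y\sim x}(f(x)-f(y))$. For a finite set $D$ of vertices let $p^D_t(x,y)=\sum_i e^{-\lambda_i t}\phi_i(x)\phi_i(y)$ for $x,y\in D$ (and $0$ otherwise), where $(\phi_i)$ is an orthonormal basis of eigenfunctions, with eigenvalues $\lambda_i$, of $\Delta$ restricted to $D$ acting on functions that vanish outside $D$. The heat kernel is $p_t(x,y)=\lim_{D\uparrow G}p^D_t(x,y)$, and $G$ is called stochastically incomplete if $\sum_{y}p_t(x,y)<1$ for some vertex $x$ and some $t>0$. For a vertex $x_0$ of $T$ and $r\ge 0$ put $\underline m(r)=\underline m_{x_0}(r)=\min\{m(x) : d(x,x_0)=r\}$, with valence and distance taken in $T$. (1) Let $T_n\subseteq T$ be a subtree that is a model tree with root $x_0$ and branching function $n$; that is, in $T_n$ the root has valence $n(0)$ and every vertex at distance $r>0$ from $x_0$ has valence $n(r)+1$. Suppose that $n(r)\le\underline m_{x_0}(r)-1$ for all $r>0$. If $T_n$ is stochastically incomplete, then so is $T$. (2) If for some vertex $x_0$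 of $T$ we have $\underline m_{x_0}(r)>1$ for all $r\ge 0$ and $\sum_{r=0}^\infty 1/\underline m_{x_0}(r)<\infty$, then $T$ is stochastically incomplete. -/

import Mathlib

open Filter

noncomputable section

namespace StochTree

variable {V : Type*}

/-- The combinatorial Laplacian `Δ f (x) = ∑_{y ∼ x} (f x - f y)`. -/
def laplacian (G : SimpleGraph V) [G.LocallyFinite] (f : V → ℝ) (x : V) : ℝ :=
  ∑ y ∈ G.neighborFinset x, (f x - f y)

open Classical in
/-- The matrix of the reduced (Dirichlet) Laplacian of a finite set `D` of vertices: it acts on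
the functions that vanish outside `D`, and its `(x, y)` entry is `(Δ δ_y)(x)` with the Laplacian
of the whole graph. In particular the diagonal entry at `x` is the valence of `x` in `G`. For a
finite subgraph `B` with boundary `∂ B`, the reduced Laplacian on `C(B, ∂ B)` is the
case `D = int B`. -/
def reducedLaplacian (G : SimpleGraph V) [G.LocallyFinite] (D : Finset V) : Matrix D D ℝ :=
  Matrix.of fun x y => laplacian G (fun z => if z = (y : V) then 1 else 0) x

open Classical in
theorem reducedLaplacian_apply (G : SimpleGraph V) [G.LocallyFinite] (D : Finset V) (x y : D) :
    reducedLaplacian G D x y =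
      if x = y then (G.degree (x : V) : ℝ) else if G.Adj x y then -1 else 0 := by
  simp only [reducedLaplacian, laplacian, Matrix.of_apply, Finset.sum_sub_distrib,
    Finset.sum_const, nsmul_eq_mul, Finset.sum_ite_eq', SimpleGraph.mem_neighborFinset,
    SimpleGraph.card_neighborFinset_eq_degree]
  by_cases h : x = y
  · subst h; simp
  · have h' : (x : V) ≠ y := fun e => h (Subtype.ext e)
    simp only [h, h', if_false]
    split_ifs <;> simp

theorem reducedLaplacian_isHermitian (G : SimpleGraph V) [G.LocallyFinite] (D : Finset V) :
    (reducedLaplacian G D).IsHermitian := by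
  classical
  ext x y
  simp only [Matrix.conjTranspose_apply, reducedLaplacian_apply, star_trivial]
  by_cases h : x = y
  · subst h; simp
  · simp [h, Ne.symm h, G.adj_comm]

open Classical in
/-- The Dirichlet heat kernel of a finite set `D` of vertices,
`p_t^D(x, y) = ∑_i exp (- λ_i t) φ_i(x) φ_i(y)`, where the `φ_i` are an orthonormal basis of
eigenfunctions of the reduced Laplacian with eigenvalues `λ_i`; it is extended by `0` to
all pairs of vertices. -/
def dirichletHeatKernel (G : SimpleGraph V) [G.LocallyFinite] (D : Finset V)
    (t : ℝ) (x y : V) : ℝ :=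
  if h : x ∈ D ∧ y ∈ D then
    ∑ i : D, Real.exp (-(reducedLaplacian_isHermitian G D).eigenvalues i * t) *
      (reducedLaplacian_isHermitian G D).eigenvectorBasis i ⟨x, h.1⟩ *
      (reducedLaplacian_isHermitian G D).eigenvectorBasis i ⟨y, h.2⟩
  else 0

/-- The heat kernel `p_t(x, y)` of `G`: the limit of the Dirichlet heat kernels (which increase
with the set) as the finite set of vertices exhausts `G`. -/
def heatKernel (G : SimpleGraph V) [G.LocallyFinite] (t : ℝ) (x y : V) : ℝ :=
  limUnder (atTop : Filter (Finset V)) fun D => dirichletHeatKernel G D t x y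

/-- `G` is stochastically incomplete: `P_t 1 (x) = ∑_y p_t(x, y) < 1` for some vertex `x` and
some `t > 0`. -/
def StochasticallyIncomplete (G : SimpleGraph V) [G.LocallyFinite] : Prop :=
  ∃ (x : V) (t : ℝ), 0 < t ∧ ∑' y : V, heatKernel G t x y < 1

/-- `G` is a model tree with root `x₀` and branching function `n`: the valence is constant on
the spheres about `x₀`, equal to `n 0` at `x₀` and to `n r + 1` on the sphere of
radius `r > 0`. -/
structure IsModelTree (G : SimpleGraph V) [G.LocallyFinite] (x₀ : V) (n : ℕ → ℕ) : Prop where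
  isTree : G.IsTree
  degree_root : G.degree x₀ = n 0
  degree_sphere : ∀ r > 0, ∀ x, G.dist x₀ x = r → G.degree x = n r + 1

/-- The minimal valence on the sphere of radius `r` about `x₀` (the spheres of an infinite,
locally finite, connected graph are not empty). -/
def minValence (G : SimpleGraph V) [G.LocallyFinite] (x₀ : V) (r : ℕ) : ℕ :=
  sInf ((fun x => G.degree x) '' {x | G.dist x₀ x = r})

end StochTree

end

/-!
The heat kernel is controlled through the Dirichlet heat flow on finite sets `D`. A weak maximum
principle (`nonpos_of_heat_subsolution`) shows that the Dirichlet heat kernels are nonnegative, of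
total mass at most `1` and increasing in `D`, so the limit defining the heat kernel exists. Two
further comparisons, uniform in `D`, give criteria for a general locally finite graph:

* a nonzero bounded function `v ≥ 0` with `Δ v ≤ -c v`, `c > 0`, forces stochastic incompleteness
  (`stochasticallyIncomplete_of_subharmonic`), because `exp (c t) v` is a subsolution of the heat
  equation that eventually exceeds the bound `M` of `v`, which conservation of heat would forbid;
* a function `v ≥ 0` with `Δ v ≥ -c v` and finite sublevel sets excludes it
  (`not_stochasticallyIncomplete_of_superharmonic`, Khasminskii's criterion).

On a model tree both apply to one function, the radial solution `v` of `Δ v = -c v`, which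
increases with the distance to the root. If `v` is unbounded, then its sublevel sets are finite, so
an incomplete model tree has a bounded radial solution (`IsModelTree.ne_zero_and_bounded`).
Transplanted to a tree that branches at least as much, `v` satisfies `Δ v ≤ -c v` precisely because
it increases (`stochasticallyIncomplete_of_bounded_radialSolution`); this proves the comparison
statement. For the summability criterion the branching function is the minimal valence minus one,
and the recursion `v (r + 1) ≤ v r (1 + (c + 1) / n r)` bounds the radial solution
(`radialSolution_le_exp_tsum`). No model subtree is needed, since the radial solution is defined by
its recursion alone.
-/

namespace StochTree

/-! ### The Laplacian and the maximum principle -/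

section Laplacian

variable {V : Type*} (G : SimpleGraph V) [G.LocallyFinite]

theorem laplacian_add (f g : V → ℝ) (x : V) :
    laplacian G (fun z => f z + g z) x = laplacian G f x + laplacian G g x := by
  simp only [laplacian, ← Finset.sum_add_distrib]
  exact Finset.sum_congr rfl fun y _ => by ring

theorem laplacian_sub (f g : V → ℝ) (x : V) :
    laplacian G (fun z => f z - g z) x = laplacian G f x - laplacian G g x := by
  simp only [laplacian, ← Finset.sum_sub_distrib]
  exact Finset.sum_congr rfl fun y _ => by ring

theorem laplacian_const_mul (c : ℝ) (f : V → ℝ) (x : V) :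
    laplacian G (fun z => c * f z) x = c * laplacian G f x := by
  simp only [laplacian, Finset.mul_sum]
  exact Finset.sum_congr rfl fun y _ => by ring

theorem laplacian_const (c : ℝ) (x : V) : laplacian G (fun _ => c) x = 0 := by
  simp [laplacian]

theorem laplacian_sum {ι : Type*} (s : Finset ι) (f : ι → V → ℝ) (x : V) :
    laplacian G (fun z => ∑ i ∈ s, f i z) x = ∑ i ∈ s, laplacian G (f i) x := by
  simp only [laplacian, ← Finset.sum_sub_distrib]
  exact Finset.sum_comm

theorem laplacian_eq_sum_reducedLaplacian (D : Finset V) (f : V → ℝ) (hf : ∀ z ∉ D, f z = 0)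
    (x : D) : laplacian G f x = ∑ z : D, reducedLaplacian G D x z * f z := by
  classical
  have hf' : f = fun w => ∑ z : D, f z * (if w = (z : V) then 1 else 0) := by
    funext w
    rw [Finset.sum_coe_sort D (fun z => f z * (if w = z then 1 else 0))]
    by_cases hw : w ∈ D <;> simp [hw, hf]
  conv_lhs => rw [hf']
  rw [laplacian_sum]
  refine Finset.sum_congr rfl fun z _ => ?_
  rw [laplacian_const_mul, mul_comm]
  simp only [reducedLaplacian, Matrix.of_apply]

/-- Weak maximum principle for the heat equation on a finite set `D`: a subsolution that is
nonpositive at time `0` and outside `D` is nonpositive. -/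
theorem nonpos_of_heat_subsolution (D : Finset V) {T : ℝ} (hT : 0 ≤ T) (u u' : ℝ → V → ℝ)
    (hderiv : ∀ t ∈ Set.Icc 0 T, ∀ x ∈ D, HasDerivAt (fun s => u s x) (u' t x) t)
    (hsub : ∀ t ∈ Set.Icc 0 T, ∀ x ∈ D, u' t x ≤ -laplacian G (u t) x)
    (hout : ∀ t ∈ Set.Icc 0 T, ∀ x ∉ D, u t x ≤ 0)
    (hinit : ∀ x ∈ D, u 0 x ≤ 0) (x : V) : u T x ≤ 0 := by
  by_contra! hpos
  have hxD : x ∈ D := by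
    by_contra h
    exact absurd (hout T ⟨hT, le_rfl⟩ x h) (not_le.mpr hpos)
  -- The penalty `ε t` makes the inequality strict; this `ε` keeps `u - ε t` positive at `(T, x)`.
  set ε := u T x / (T + 1) with hε
  have hε0 : 0 < ε := by positivity
  have hεT : ε * T < u T x := by
    rw [hε, div_mul_eq_mul_div, div_lt_iff₀ (by positivity)]
    nlinarith
  have hne : (Set.Icc 0 T).Nonempty := ⟨0, le_rfl, hT⟩
  have hmax : ∀ y ∈ D, ∃ t ∈ Set.Icc 0 T, ∀ s ∈ Set.Icc 0 T, u s y - ε * s ≤ u t y - ε * t := by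
    intro y hy
    refine isCompact_Icc.exists_isMaxOn hne (f := fun s => u s y - ε * s) ?_
    exact ContinuousOn.sub (fun t ht => (hderiv t ht y hy).continuousAt.continuousWithinAt)
      (by fun_prop)
  choose! τ hτ hτmax using hmax
  obtain ⟨y, hy, hymax⟩ := D.exists_max_image (fun z => u (τ z) z - ε * τ z) ⟨x, hxD⟩
  have hglob : ∀ z ∈ D, ∀ s ∈ Set.Icc 0 T, u s z - ε * s ≤ u (τ y) y - ε * τ y :=
    fun z hz s hs => (hτmax z hz s hs).trans (hymax z hz)
  have hval : 0 < u (τ y) y - ε * τ y := by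
    have := hglob x hxD T ⟨hT, le_rfl⟩
    linarith
  have h0 : 0 < τ y := by
    rcases (hτ y hy).1.eq_or_lt with h | h
    · rw [← h] at hval
      linarith [hinit y hy]
    · exact h
  have hlap : 0 ≤ laplacian G (u (τ y)) y := by
    refine Finset.sum_nonneg fun z _ => ?_
    by_cases hz : z ∈ D
    · linarith [hglob z hz _ (hτ y hy)]
    · have := hout _ (hτ y hy) z hz
      have : 0 ≤ ε * τ y := by positivity
      linarith
  have hd : HasDerivAt (fun s => u s y - ε * s) (u' (τ y) y - ε * 1) (τ y) :=
    (hderiv _ (hτ y hy) y hy).sub ((hasDerivAt_id _).const_mul ε)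
  have hslope := (hasDerivAt_iff_tendsto_slope.mp hd).mono_left
    (nhdsWithin_mono _ (fun s (hs : s < τ y) => hs.ne) : nhdsWithin (τ y) (Set.Iio (τ y)) ≤ _)
  have hge : 0 ≤ u' (τ y) y - ε * 1 := by
    refine ge_of_tendsto hslope ?_
    filter_upwards [Ioo_mem_nhdsLT h0] with s hs
    rw [slope_def_field]
    refine div_nonneg_of_nonpos ?_ (by linarith [hs.2])
    linarith [hτmax y hy s ⟨hs.1.le, hs.2.le.trans (hτ y hy).2⟩]
  linarith [hsub _ (hτ y hy) y hy]

end Laplacian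

/-! ### Dirichlet heat kernels -/

section DirichletHeatKernel

variable {V : Type*} (G : SimpleGraph V) [G.LocallyFinite] (D : Finset V)

theorem dirichletHeatKernel_of_notMem_left (t : ℝ) {x : V} (hx : x ∉ D) (y : V) :
    dirichletHeatKernel G D t x y = 0 := by
  simp [dirichletHeatKernel, hx]

theorem dirichletHeatKernel_of_notMem_right (t : ℝ) (x : V) {y : V} (hy : y ∉ D) :
    dirichletHeatKernel G D t x y = 0 := by
  simp [dirichletHeatKernel, hy]

open Classical in
/-- The completeness relation of the orthonormal eigenbasis, read as an initial condition. -/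
theorem dirichletHeatKernel_zero {x y : V} (hx : x ∈ D) (hy : y ∈ D) :
    dirichletHeatKernel G D 0 x y = if x = y then 1 else 0 := by
  have h := (reducedLaplacian_isHermitian G D).eigenvectorBasis.sum_inner_mul_inner
    (EuclideanSpace.single (⟨x, hx⟩ : D) (1 : ℝ)) (EuclideanSpace.single (⟨y, hy⟩ : D) (1 : ℝ))
  simp only [EuclideanSpace.inner_single_left, EuclideanSpace.inner_single_right] at h
  simp only [dirichletHeatKernel, hx, hy, and_self, dif_pos, mul_zero, Real.exp_zero, one_mul]
  simpa [Subtype.ext_iff, Pi.single_apply, eq_comm (a := y)] using h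

theorem hasDerivAt_dirichletHeatKernel (t : ℝ) {x : V} (hx : x ∈ D) (y : V) :
    HasDerivAt (fun s => dirichletHeatKernel G D s x y)
      (-laplacian G (fun z => dirichletHeatKernel G D t z y) x) t := by
  classical
  by_cases hy : y ∈ D
  · have hA := reducedLaplacian_isHermitian G D
    rw [laplacian_eq_sum_reducedLaplacian G D _
      (fun z hz => dirichletHeatKernel_of_notMem_left G D t hz y) ⟨x, hx⟩]
    have hd : HasDerivAt (fun s => dirichletHeatKernel G D s x y)
        (∑ i : D, Real.exp (-hA.eigenvalues i * t) * (-hA.eigenvalues i * 1) *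
          hA.eigenvectorBasis i ⟨x, hx⟩ * hA.eigenvectorBasis i ⟨y, hy⟩) t := by
      simp only [dirichletHeatKernel, hx, hy, and_self, dif_pos]
      refine HasDerivAt.fun_sum fun i _ => ?_
      convert! ((((hasDerivAt_id t).const_mul (-hA.eigenvalues i)).exp).mul_const _).mul_const _
        using 1
    convert! hd using 1
    have heig : ∀ i, ∑ z : D, reducedLaplacian G D ⟨x, hx⟩ z * hA.eigenvectorBasis i z =
        hA.eigenvalues i * hA.eigenvectorBasis i ⟨x, hx⟩ := fun i => by
      simpa [Matrix.mulVec, dotProduct] using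
        congrFun (hA.mulVec_eigenvectorBasis i) ⟨x, hx⟩
    simp only [dirichletHeatKernel, hy, Subtype.coe_eta, Finset.coe_mem, and_self, dif_pos,
      Finset.mul_sum]
    rw [Finset.sum_comm, ← Finset.sum_neg_distrib]
    refine Finset.sum_congr rfl fun i _ => ?_
    rw [show Real.exp (-hA.eigenvalues i * t) * (-hA.eigenvalues i * 1) *
          hA.eigenvectorBasis i ⟨x, hx⟩ * hA.eigenvectorBasis i ⟨y, hy⟩ =
        -((hA.eigenvalues i * hA.eigenvectorBasis i ⟨x, hx⟩) *
          (Real.exp (-hA.eigenvalues i * t) * hA.eigenvectorBasis i ⟨y, hy⟩)) by ring,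
      ← heig, Finset.sum_mul]
    congr 1
    refine Finset.sum_congr rfl fun z _ => ?_
    ring
  · simp only [dirichletHeatKernel_of_notMem_right G D _ _ hy, laplacian_const, neg_zero]
    exact hasDerivAt_const _ _

theorem dirichletHeatKernel_nonneg {t : ℝ} (ht : 0 ≤ t) (x y : V) :
    0 ≤ dirichletHeatKernel G D t x y := by
  have h := nonpos_of_heat_subsolution G D ht (fun s z => (-1) * dirichletHeatKernel G D s z y)
    (fun s z => (-1) * -laplacian G (fun w => dirichletHeatKernel G D s w y) z)
    (fun s _ z hz => (hasDerivAt_dirichletHeatKernel G D s hz y).const_mul _)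
    (fun s _ z _ => by rw [laplacian_const_mul]; linarith)
    (fun s _ z hz => by simp [dirichletHeatKernel_of_notMem_left G D s hz])
    (fun z hz => by
      by_cases hy : y ∈ D
      · rw [dirichletHeatKernel_zero G D hz hy]
        split_ifs <;> norm_num
      · simp [dirichletHeatKernel_of_notMem_right G D 0 z hy]) x
  linarith

theorem dirichletHeatKernel_mono {D D' : Finset V} (hD : D ⊆ D') {t : ℝ} (ht : 0 ≤ t) (x y : V) :
    dirichletHeatKernel G D t x y ≤ dirichletHeatKernel G D' t x y := by
  have h := nonpos_of_heat_subsolution G D ht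
    (fun s z => dirichletHeatKernel G D s z y - dirichletHeatKernel G D' s z y)
    (fun s z => -laplacian G (fun w => dirichletHeatKernel G D s w y) z -
      -laplacian G (fun w => dirichletHeatKernel G D' s w y) z)
    (fun s _ z hz => (hasDerivAt_dirichletHeatKernel G D s hz y).sub
      (hasDerivAt_dirichletHeatKernel G D' s (hD hz) y))
    (fun s _ z _ => by rw [laplacian_sub]; linarith)
    (fun s hs z hz => by
      simpa [dirichletHeatKernel_of_notMem_left G D s hz] using
        dirichletHeatKernel_nonneg G D' hs.1 z y)
    (fun z hz => by
      by_cases hy : y ∈ D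
      · rw [dirichletHeatKernel_zero G D hz hy, dirichletHeatKernel_zero G D' (hD hz) (hD hy),
          sub_self]
      · simpa [dirichletHeatKernel_of_notMem_right G D 0 z hy] using
          dirichletHeatKernel_nonneg G D' le_rfl z y) x
  linarith

/-- The total mass `∑_y p_t^D(x, y)`: the probability that the heat flow started at `x` has not
left `D` before the time `t`. -/
noncomputable def dirichletMass (t : ℝ) (x : V) : ℝ :=
  ∑ y ∈ D, dirichletHeatKernel G D t x y

theorem hasDerivAt_dirichletMass (t : ℝ) {x : V} (hx : x ∈ D) :
    HasDerivAt (fun s => dirichletMass G D s x) (-laplacian G (dirichletMass G D t) x) t := by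
  have h := HasDerivAt.fun_sum fun y (_ : y ∈ D) => hasDerivAt_dirichletHeatKernel G D t hx y
  rwa [Finset.sum_neg_distrib, ← laplacian_sum] at h

theorem dirichletMass_zero {x : V} (hx : x ∈ D) : dirichletMass G D 0 x = 1 := by
  classical
  rw [dirichletMass, Finset.sum_congr rfl fun y hy => dirichletHeatKernel_zero G D hx hy]
  simp [hx]

theorem dirichletMass_of_notMem (t : ℝ) {x : V} (hx : x ∉ D) : dirichletMass G D t x = 0 :=
  Finset.sum_eq_zero fun y _ => dirichletHeatKernel_of_notMem_left G D t hx y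

theorem dirichletMass_le_one {t : ℝ} (ht : 0 ≤ t) (x : V) : dirichletMass G D t x ≤ 1 := by
  have h := nonpos_of_heat_subsolution G D ht (fun s z => dirichletMass G D s z - 1)
    (fun s z => -laplacian G (dirichletMass G D s) z)
    (fun s _ z hz => (hasDerivAt_dirichletMass G D s hz).sub_const 1)
    (fun s _ z _ => by rw [laplacian_sub, laplacian_const, sub_zero])
    (fun s _ z hz => by simp [dirichletMass_of_notMem G D s hz])
    (fun z hz => by simp [dirichletMass_zero G D hz]) x
  linarith

/-- A bounded `c`-subharmonic function forces a loss of heat that does not depend on the finite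
set: up to time `t` the subsolution `exp (c s) v` stays below
`M + M exp (c t) (1 - ∑_y p_s^D)`. -/
theorem exp_mul_le_of_subharmonic {c M : ℝ} (hc : 0 ≤ c) {v : V → ℝ}
    (hv : ∀ x, 0 ≤ v x) (hvM : ∀ x, v x ≤ M)
    (hsub : ∀ x, laplacian G v x ≤ -c * v x) {t : ℝ} (ht : 0 ≤ t) (x : V) :
    Real.exp (c * t) * v x ≤ M + M * Real.exp (c * t) * (1 - dirichletMass G D t x) := by
  have hM : 0 ≤ M := (hv x).trans (hvM x)
  set K := M * Real.exp (c * t) with hK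
  have hK0 : 0 ≤ K := by positivity
  have h := nonpos_of_heat_subsolution G D ht
    (fun s z => Real.exp (c * s) * v z + K * dirichletMass G D s z - (M + K))
    (fun s z => Real.exp (c * s) * (c * 1) * v z + K * -laplacian G (dirichletMass G D s) z)
    (fun s _ z hz => ((((hasDerivAt_id s).const_mul c).exp.mul_const (v z)).add
      ((hasDerivAt_dirichletMass G D s hz).const_mul K)).sub_const (M + K))
    (fun s _ z _ => by
      rw [laplacian_sub, laplacian_add, laplacian_const, laplacian_const_mul,
        laplacian_const_mul]
      nlinarith [mul_le_mul_of_nonneg_left (hsub z) (Real.exp_pos (c * s)).le])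
    (fun s hs z hz => by
      rw [dirichletMass_of_notMem G D s hz]
      have h1 : Real.exp (c * s) ≤ Real.exp (c * t) :=
        Real.exp_le_exp.mpr (mul_le_mul_of_nonneg_left hs.2 hc)
      have h2 : Real.exp (c * s) * v z ≤ Real.exp (c * t) * M :=
        mul_le_mul h1 (hvM z) (hv z) (Real.exp_pos _).le
      linarith)
    (fun z hz => by
      rw [dirichletMass_zero G D hz, mul_zero, Real.exp_zero]
      linarith [hvM z]) x
  linarith

/-- A `c`-superharmonic function that exceeds `C` outside `D` bounds the loss of heat
from `D`. -/
theorem one_sub_dirichletMass_le_of_superharmonic {c C : ℝ} (hc : 0 ≤ c) (hC : 0 < C) {v : V → ℝ}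
    (hv : ∀ x, 0 ≤ v x) (hsuper : ∀ x, -c * v x ≤ laplacian G v x) (hD : ∀ x ∉ D, C ≤ v x)
    {t : ℝ} (ht : 0 ≤ t) (x : V) :
    1 - dirichletMass G D t x ≤ Real.exp (c * t) * v x / C := by
  have h := nonpos_of_heat_subsolution G D ht
    (fun s z => C - (Real.exp (c * s) * v z + C * dirichletMass G D s z))
    (fun s z => -(Real.exp (c * s) * (c * 1) * v z + C * -laplacian G (dirichletMass G D s) z))
    (fun s _ z hz => ((((hasDerivAt_id s).const_mul c).exp.mul_const (v z)).add
      ((hasDerivAt_dirichletMass G D s hz).const_mul C)).const_sub C)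
    (fun s _ z _ => by
      rw [laplacian_sub, laplacian_add, laplacian_const, laplacian_const_mul,
        laplacian_const_mul]
      nlinarith [mul_le_mul_of_nonneg_left (hsuper z) (Real.exp_pos (c * s)).le])
    (fun s hs z hz => by
      rw [dirichletMass_of_notMem G D s hz]
      have h1 : 1 ≤ Real.exp (c * s) := Real.one_le_exp (mul_nonneg hc hs.1)
      nlinarith [hD z hz, hv z])
    (fun z hz => by
      rw [dirichletMass_zero G D hz, mul_zero, Real.exp_zero]
      linarith [hv z]) x
  rw [le_div_iff₀ hC]
  linarith

end DirichletHeatKernel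

/-! ### The heat kernel of the graph -/

section HeatKernel

variable {V : Type*} (G : SimpleGraph V) [G.LocallyFinite]

theorem dirichletHeatKernel_le_one (D : Finset V) {t : ℝ} (ht : 0 ≤ t) (x y : V) :
    dirichletHeatKernel G D t x y ≤ 1 := by
  by_cases hy : y ∈ D
  · exact (Finset.single_le_sum (fun z _ => dirichletHeatKernel_nonneg G D ht x z) hy).trans
      (dirichletMass_le_one G D ht x)
  · simp [dirichletHeatKernel_of_notMem_right G D t x hy]

/-- The limit that defines the heat kernel exists, by monotonicity. -/
theorem tendsto_dirichletHeatKernel {t : ℝ} (ht : 0 ≤ t) (x y : V) :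
    Tendsto (fun D : Finset V => dirichletHeatKernel G D t x y) atTop
      (nhds (heatKernel G t x y)) := by
  refine tendsto_nhds_limUnder ⟨_, tendsto_atTop_ciSup
    (fun D D' hD => dirichletHeatKernel_mono G hD ht x y) ⟨1, ?_⟩⟩
  rintro _ ⟨D, rfl⟩
  exact dirichletHeatKernel_le_one G D ht x y

theorem dirichletHeatKernel_le_heatKernel (D : Finset V) {t : ℝ} (ht : 0 ≤ t) (x y : V) :
    dirichletHeatKernel G D t x y ≤ heatKernel G t x y :=
  Monotone.ge_of_tendsto (f := fun D : Finset V => dirichletHeatKernel G D t x y)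
    (fun _ _ hD => dirichletHeatKernel_mono G hD ht x y) (tendsto_dirichletHeatKernel G ht x y) D

theorem heatKernel_nonneg {t : ℝ} (ht : 0 ≤ t) (x y : V) : 0 ≤ heatKernel G t x y :=
  (dirichletHeatKernel_nonneg G ∅ ht x y).trans (dirichletHeatKernel_le_heatKernel G ∅ ht x y)

theorem sum_heatKernel_le {t B : ℝ} (ht : 0 ≤ t) {x : V}
    (hB : ∀ D : Finset V, dirichletMass G D t x ≤ B) (F : Finset V) :
    ∑ y ∈ F, heatKernel G t x y ≤ B := by
  refine le_of_tendsto (tendsto_finsetSum F fun y _ => tendsto_dirichletHeatKernel G ht x y) ?_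
  filter_upwards [eventually_ge_atTop F] with D hD
  exact (Finset.sum_le_sum_of_subset_of_nonneg hD
    fun y _ _ => dirichletHeatKernel_nonneg G D ht x y).trans (hB D)

theorem tsum_heatKernel_le {t B : ℝ} (ht : 0 ≤ t) {x : V}
    (hB : ∀ D : Finset V, dirichletMass G D t x ≤ B) : ∑' y, heatKernel G t x y ≤ B :=
  Real.tsum_le_of_sum_le (heatKernel_nonneg G ht x) (sum_heatKernel_le G ht hB)

theorem summable_heatKernel {t : ℝ} (ht : 0 ≤ t) (x : V) : Summable (heatKernel G t x) :=
  summable_of_sum_le (heatKernel_nonneg G ht x)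
    (sum_heatKernel_le G ht fun D => dirichletMass_le_one G D ht x)

theorem dirichletMass_le_tsum_heatKernel (D : Finset V) {t : ℝ} (ht : 0 ≤ t) (x : V) :
    dirichletMass G D t x ≤ ∑' y, heatKernel G t x y :=
  (Finset.sum_le_sum fun y _ => dirichletHeatKernel_le_heatKernel G D ht x y).trans
    ((summable_heatKernel G ht x).sum_le_tsum D fun y _ => heatKernel_nonneg G ht x y)

variable {G}

/-- A graph that carries a nonzero bounded nonnegative function `v` with `Δ v ≤ -c v`, where
`c > 0`, is stochastically incomplete. -/
theorem stochasticallyIncomplete_of_subharmonic {c M : ℝ} (hc : 0 < c) {v : V → ℝ}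
    (hv : ∀ x, 0 ≤ v x) (hvM : ∀ x, v x ≤ M) (hsub : ∀ x, laplacian G v x ≤ -c * v x)
    {x : V} (hx : 0 < v x) : StochasticallyIncomplete G := by
  have hM : 0 < M := hx.trans_le (hvM x)
  -- At this time `exp (c t) v x` has outgrown `M`.
  obtain ⟨t, ht, hMt⟩ : ∃ t : ℝ, 0 < t ∧ M < Real.exp (c * t) * v x := by
    refine ⟨M / v x / c, by positivity, ?_⟩
    rw [mul_div_cancel₀ _ hc.ne', ← div_lt_iff₀ hx]
    linarith [Real.add_one_le_exp (M / v x)]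
  refine ⟨x, t, ht, ?_⟩
  have hK : 0 < M * Real.exp (c * t) := by positivity
  have hB : ∀ D : Finset V, dirichletMass G D t x ≤
      1 - (Real.exp (c * t) * v x - M) / (M * Real.exp (c * t)) := fun D => by
    have h := exp_mul_le_of_subharmonic G D hc.le hv hvM hsub ht.le x
    have : (Real.exp (c * t) * v x - M) / (M * Real.exp (c * t)) ≤ 1 - dirichletMass G D t x := by
      rw [div_le_iff₀ hK]
      linarith
    linarith
  have hpos : 0 < (Real.exp (c * t) * v x - M) / (M * Real.exp (c * t)) :=
    div_pos (by linarith) hK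
  linarith [tsum_heatKernel_le G ht.le hB]

/-- Khasminskii's criterion: a graph that carries a nonnegative function `v` with finite sublevel
sets and `Δ v ≥ -c v` is not stochastically incomplete. -/
theorem not_stochasticallyIncomplete_of_superharmonic {c : ℝ} (hc : 0 ≤ c) {v : V → ℝ}
    (hv : ∀ x, 0 ≤ v x) (hsuper : ∀ x, -c * v x ≤ laplacian G v x)
    (hproper : ∀ C : ℝ, {x | v x ≤ C}.Finite) : ¬ StochasticallyIncomplete G := by
  rintro ⟨x, t, ht, hlt⟩
  have hlim : Tendsto (fun C : ℝ => Real.exp (c * t) * v x / C) atTop (nhds 0) :=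
    tendsto_const_nhds.div_atTop tendsto_id
  refine absurd (ge_of_tendsto hlim ?_) (not_le.mpr (sub_pos.mpr hlt))
  filter_upwards [eventually_gt_atTop 0] with C hC
  have h := one_sub_dirichletMass_le_of_superharmonic G (hproper C).toFinset hc hC hv hsuper
    (fun z hz => by
      simp only [Set.Finite.mem_toFinset, Set.mem_ofPred_eq, not_le] at hz
      exact hz.le) ht.le x
  linarith [dirichletMass_le_tsum_heatKernel G (hproper C).toFinset ht.le x]

end HeatKernel

/-! ### Radial functions on trees -/

section Radial

variable {V : Type*} {G : SimpleGraph V}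

theorem exists_adj_dist_eq (hG : G.Connected) {x₀ x : V} {k : ℕ} (hx : G.dist x₀ x = k + 1) :
    ∃ y, G.Adj x y ∧ G.dist x₀ y = k := by
  obtain ⟨p, hp⟩ := hG.exists_walk_length_eq_dist x x₀
  rw [G.dist_comm, hx] at hp
  cases p with
  | nil => simp at hp
  | cons h q =>
    rename_i y
    refine ⟨y, h, le_antisymm ?_ ?_⟩
    · have := SimpleGraph.dist_le q
      rw [SimpleGraph.Walk.length_cons] at hp
      rw [G.dist_comm]
      omega
    · have := hG.dist_triangle (u := x₀) (v := y) (w := x)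
      rw [SimpleGraph.dist_eq_one_iff_adj.mpr h.symm] at this
      omega

/-- In a tree, a vertex off the root has exactly one neighbour closer to the root; all other
neighbours are farther from it. -/
theorem exists_parent (hG : G.IsTree) {x₀ x : V} {k : ℕ} (hx : G.dist x₀ x = k + 1) :
    ∃ y, G.Adj x y ∧ G.dist x₀ y = k ∧ ∀ z, G.Adj x z → z ≠ y → G.dist x₀ z = k + 2 := by
  obtain ⟨y, hxy, hy⟩ := exists_adj_dist_eq hG.connected hx
  refine ⟨y, hxy, hy, fun z hxz hzy => ?_⟩
  by_contra hz
  have hzk : G.dist x₀ z = k := by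
    have h1 := hG.dist_ne_of_adj x₀ hxz
    have h2 := hxz.diff_dist_adj (u := x₀)
    omega
  -- Both neighbours would continue to geodesics from `x` to `x₀`.
  obtain ⟨p, hp⟩ := hG.connected.exists_walk_length_eq_dist y x₀
  obtain ⟨q, hq⟩ := hG.connected.exists_walk_length_eq_dist z x₀
  rw [G.dist_comm] at hp hq
  have hp' : (SimpleGraph.Walk.cons hxy p).IsPath :=
    SimpleGraph.Walk.isPath_of_length_eq_dist _ (by
      rw [SimpleGraph.Walk.length_cons, G.dist_comm, hx, hp, hy])
  have hq' : (SimpleGraph.Walk.cons hxz q).IsPath :=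
    SimpleGraph.Walk.isPath_of_length_eq_dist _ (by
      rw [SimpleGraph.Walk.length_cons, G.dist_comm, hx, hq, hzk])
  have h := (hG.existsUnique_path x x₀).unique hp' hq'
  injection h with _ h'
  exact hzy h'.symm

variable [G.LocallyFinite]

theorem finite_setOf_dist_le (hG : G.Connected) (x₀ : V) (R : ℕ) :
    {x | G.dist x₀ x ≤ R}.Finite := by
  classical
  induction R with
  | zero =>
    refine (Set.finite_singleton x₀).subset fun x hx => ?_
    exact ((hG.dist_eq_zero_iff).mp (Nat.le_zero.mp hx)).symm
  | succ R ih =>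
    refine (ih.union (ih.biUnion fun y _ => (G.neighborFinset y).finite_toSet)).subset
      fun x (hx : G.dist x₀ x ≤ R + 1) => ?_
    rcases hx.lt_or_eq with h | h
    · exact Or.inl (Nat.lt_succ_iff.mp h)
    · obtain ⟨y, hxy, hy⟩ := exists_adj_dist_eq hG h
      refine Or.inr (Set.mem_biUnion (show G.dist x₀ y ≤ R from hy.le) ?_)
      simpa using hxy.symm

theorem laplacian_radial_root (x₀ : V) (f : ℕ → ℝ) :
    laplacian G (fun z => f (G.dist x₀ z)) x₀ = -(G.degree x₀ * (f 1 - f 0)) := by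
  have h : ∀ y ∈ G.neighborFinset x₀, f (G.dist x₀ x₀) - f (G.dist x₀ y) = f 0 - f 1 := by
    intro y hy
    rw [SimpleGraph.dist_self,
      SimpleGraph.dist_eq_one_iff_adj.mpr ((G.mem_neighborFinset _ _).mp hy)]
  rw [laplacian, Finset.sum_congr rfl h, Finset.sum_const, nsmul_eq_mul,
    G.card_neighborFinset_eq_degree]
  ring

theorem laplacian_radial (hG : G.IsTree) {x₀ x : V} {k : ℕ} (hx : G.dist x₀ x = k + 1)
    (f : ℕ → ℝ) :
    laplacian G (fun z => f (G.dist x₀ z)) x =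
      (f (k + 1) - f k) - (G.degree x - 1) * (f (k + 2) - f (k + 1)) := by
  classical
  obtain ⟨y, hxy, hy, hz⟩ := exists_parent hG hx
  have hmem : y ∈ G.neighborFinset x := by simpa using hxy
  have hrest : ∀ z ∈ (G.neighborFinset x).erase y,
      f (G.dist x₀ x) - f (G.dist x₀ z) = f (k + 1) - f (k + 2) := by
    intro z hz'
    rw [Finset.mem_erase, SimpleGraph.mem_neighborFinset] at hz'
    rw [hx, hz z hz'.2 hz'.1]
  rw [laplacian, ← Finset.add_sum_erase _ _ hmem, Finset.sum_congr rfl hrest, Finset.sum_const,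
    nsmul_eq_mul, hx, hy, Finset.cast_card_erase_of_mem hmem, G.card_neighborFinset_eq_degree]
  ring

/-- A model tree whose branching function vanishes at some radius has no vertices beyond it. -/
theorem IsModelTree.dist_le {x₀ : V} {n : ℕ → ℕ} (h : IsModelTree G x₀ n) {r : ℕ}
    (hr : n r = 0) (x : V) : G.dist x₀ x ≤ r := by
  induction hk : G.dist x₀ x generalizing x with
  | zero => exact r.zero_le
  | succ k ih =>
    obtain ⟨y, hxy, hy⟩ := exists_adj_dist_eq h.isTree.connected hk
    refine Nat.succ_le_of_lt ((ih y hy).lt_of_ne ?_)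
    rintro rfl
    cases k with
    | zero =>
      have hd := h.degree_root
      rw [hr, SimpleGraph.degree, Finset.card_eq_zero] at hd
      have hmem : x ∈ G.neighborFinset x₀ :=
        (G.mem_neighborFinset _ _).mpr (SimpleGraph.dist_eq_one_iff_adj.mp hk)
      simp [hd] at hmem
    | succ j =>
      obtain ⟨z, hyz, hz⟩ := exists_adj_dist_eq h.isTree.connected hy
      have hd := h.degree_sphere (j + 1) j.succ_pos y hy
      rw [hr, zero_add, SimpleGraph.degree_eq_one_iff_existsUnique_adj] at hd
      have := hd.unique hxy.symm hyz
      subst this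
      omega

end Radial

/-! ### The radial solution on a model tree -/

section RadialSolution

/-- The radial solution `v` of `Δ v = -c v` with `v 0 = 1` on the model tree with branching
function `n`, as a function of the distance to the root. If `n r = 0` then `v (r + 1) = v r`, by
the convention for division by zero; the model tree has no vertices at that distance. -/
noncomputable def radialSolution (c : ℝ) (n : ℕ → ℕ) : ℕ → ℝ
  | 0 => 1
  | 1 => 1 + c / n 0
  | r + 2 => radialSolution c n (r + 1) +
      (c * radialSolution c n (r + 1) + (radialSolution c n (r + 1) - radialSolution c n r)) /
        n (r + 1)

variable {c : ℝ} (n : ℕ → ℕ)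

theorem one_le_radialSolution_and_le_succ (hc : 0 ≤ c) (r : ℕ) :
    1 ≤ radialSolution c n r ∧ radialSolution c n r ≤ radialSolution c n (r + 1) := by
  induction r with
  | zero =>
    have : 0 ≤ c / n 0 := by positivity
    simp only [radialSolution]
    constructor <;> linarith
  | succ r ih =>
    refine ⟨ih.1.trans ih.2, ?_⟩
    have h1 : 0 ≤ c * radialSolution c n (r + 1) :=
      mul_nonneg hc (by linarith [ih.1, ih.2])
    have h2 : 0 ≤ (c * radialSolution c n (r + 1) +
        (radialSolution c n (r + 1) - radialSolution c n r)) / n (r + 1) :=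
      div_nonneg (by linarith [ih.2]) (Nat.cast_nonneg _)
    rw [radialSolution.eq_3]
    linarith

theorem one_le_radialSolution (hc : 0 ≤ c) (r : ℕ) : 1 ≤ radialSolution c n r :=
  (one_le_radialSolution_and_le_succ n hc r).1

theorem monotone_radialSolution (hc : 0 ≤ c) : Monotone (radialSolution c n) :=
  monotone_nat_of_le_succ fun r => (one_le_radialSolution_and_le_succ n hc r).2

variable {n}

theorem mul_radialSolution_one_sub (h : n 0 ≠ 0) :
    n 0 * (radialSolution c n 1 - radialSolution c n 0) = c * radialSolution c n 0 := by
  simp only [radialSolution]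
  field_simp
  ring

theorem mul_radialSolution_succ_sub {r : ℕ} (h : n (r + 1) ≠ 0) :
    n (r + 1) * (radialSolution c n (r + 2) - radialSolution c n (r + 1)) =
      c * radialSolution c n (r + 1) + (radialSolution c n (r + 1) - radialSolution c n r) := by
  rw [radialSolution.eq_3, add_sub_cancel_left, mul_div_cancel₀ _ (Nat.cast_ne_zero.mpr h)]

theorem radialSolution_succ_le (hc : 0 ≤ c) (r : ℕ) :
    radialSolution c n (r + 1) ≤ radialSolution c n r * (1 + (c + 1) * (1 / n r)) := by
  cases r with
  | zero =>
    simp only [radialSolution]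
    have : (0 : ℝ) ≤ 1 / n 0 := by positivity
    rw [div_eq_mul_one_div]
    nlinarith
  | succ r =>
    have h1 := one_le_radialSolution n hc r
    have h2 : (0 : ℝ) ≤ 1 / n (r + 1) := by positivity
    rw [radialSolution.eq_3, div_eq_mul_one_div]
    nlinarith [mul_nonneg (zero_le_one.trans h1) h2]

theorem radialSolution_le_exp_tsum (hc : 0 ≤ c) (hn : Summable fun r => 1 / (n r : ℝ)) (r : ℕ) :
    radialSolution c n r ≤ Real.exp ((c + 1) * ∑' i, 1 / (n i : ℝ)) := by
  have hpartial : ∀ r, radialSolution c n r ≤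
      Real.exp ((c + 1) * ∑ i ∈ Finset.range r, 1 / (n i : ℝ)) := by
    intro r
    induction r with
    | zero => simp [radialSolution]
    | succ r ih =>
      rw [Finset.sum_range_succ, mul_add, Real.exp_add]
      refine (radialSolution_succ_le hc r).trans (mul_le_mul ih ?_ (by positivity) (by positivity))
      linarith [Real.add_one_le_exp ((c + 1) * (1 / (n r : ℝ)))]
  refine (hpartial r).trans (Real.exp_le_exp.mpr (mul_le_mul_of_nonneg_left ?_ (by linarith)))
  exact hn.sum_le_tsum _ fun i _ => by positivity

variable {V : Type*} {G : SimpleGraph V} [G.LocallyFinite]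

theorem IsModelTree.laplacian_radialSolution {x₀ : V} (h : IsModelTree G x₀ n)
    (hn : ∀ r, n r ≠ 0) (x : V) :
    laplacian G (fun z => radialSolution c n (G.dist x₀ z)) x =
      -c * radialSolution c n (G.dist x₀ x) := by
  rcases hx : G.dist x₀ x with _ | k
  · obtain rfl := h.isTree.connected.dist_eq_zero_iff.mp hx
    rw [laplacian_radial_root, h.degree_root, mul_radialSolution_one_sub (hn 0), neg_mul]
  · rw [laplacian_radial h.isTree hx, h.degree_sphere (k + 1) k.succ_pos x hx]
    push_cast
    rw [add_sub_cancel_right, mul_radialSolution_succ_sub (hn (k + 1))]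
    ring

/-- If a model tree is stochastically incomplete, then its branching function never vanishes and
its radial solution is bounded; otherwise Khasminskii's criterion applies to a constant function or
to the radial solution. -/
theorem IsModelTree.ne_zero_and_bounded {x₀ : V} (h : IsModelTree G x₀ n)
    (hinc : StochasticallyIncomplete G) (hc : 0 ≤ c) :
    (∀ r, n r ≠ 0) ∧ ∃ M, ∀ r, radialSolution c n r ≤ M := by
  have hn : ∀ r, n r ≠ 0 := fun r hr => by
    refine not_stochasticallyIncomplete_of_superharmonic (G := G) (v := fun _ => 1) hc
      (fun _ => zero_le_one) (fun x => ?_) (fun C => ?_) hinc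
    · rw [laplacian_const]
      linarith
    · exact (finite_setOf_dist_le h.isTree.connected x₀ r).subset fun x _ => h.dist_le hr x
  refine ⟨hn, ?_⟩
  by_contra! hunb
  refine not_stochasticallyIncomplete_of_superharmonic hc
    (fun x => zero_le_one.trans (one_le_radialSolution n hc (G.dist x₀ x)))
    (fun x => (h.laplacian_radialSolution hn x).ge) (fun C => ?_) hinc
  obtain ⟨R, hR⟩ := hunb C
  refine (finite_setOf_dist_le h.isTree.connected x₀ R).subset fun x hx => ?_
  by_contra hlt
  exact absurd ((monotone_radialSolution n hc (not_le.mp hlt).le).trans hx) (not_le.mpr hR)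

/-- A tree that branches at least as much as a model tree with bounded radial solution is
stochastically incomplete: transplanted to the tree, the increasing radial solution becomes
subharmonic. -/
theorem stochasticallyIncomplete_of_bounded_radialSolution (hG : G.IsTree) (x₀ : V)
    (hn : ∀ r, n r ≠ 0) (hroot : n 0 ≤ G.degree x₀)
    (hdeg : ∀ r > 0, ∀ x, G.dist x₀ x = r → n r + 1 ≤ G.degree x)
    (hc : 0 < c) {M : ℝ} (hM : ∀ r, radialSolution c n r ≤ M) : StochasticallyIncomplete G := by
  refine stochasticallyIncomplete_of_subharmonic (G := G) hc
    (v := fun x => radialSolution c n (G.dist x₀ x)) (x := x₀)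
    (fun x => zero_le_one.trans (one_le_radialSolution n hc.le _)) (fun x => hM _) (fun x => ?_)
    (zero_lt_one.trans_le (one_le_radialSolution n hc.le _))
  have hmono := fun r => sub_nonneg.mpr (monotone_radialSolution n hc.le (Nat.le_succ r))
  rcases hx : G.dist x₀ x with _ | k
  · obtain rfl := hG.connected.dist_eq_zero_iff.mp hx
    rw [laplacian_radial_root, neg_mul, ← mul_radialSolution_one_sub (hn 0)]
    exact neg_le_neg (mul_le_mul_of_nonneg_right (Nat.cast_le.mpr hroot) (hmono 0))
  · rw [laplacian_radial hG hx]
    have h1 : (n (k + 1) : ℝ) ≤ G.degree x - 1 := by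
      have : ((n (k + 1) + 1 : ℕ) : ℝ) ≤ G.degree x :=
        Nat.cast_le.mpr (hdeg (k + 1) k.succ_pos x hx)
      push_cast at this
      linarith
    have h2 := mul_le_mul_of_nonneg_right h1 (hmono (k + 1))
    have h3 := mul_radialSolution_succ_sub (c := c) (hn (k + 1))
    simp only [Nat.succ_eq_add_one, add_assoc, Nat.reduceAdd] at h2
    linarith

end RadialSolution

/-! ### Comparison of valences -/

theorem minValence_le_degree {V : Type*} (G : SimpleGraph V) [G.LocallyFinite] {x₀ x : V} {r : ℕ}
    (hx : G.dist x₀ x = r) : minValence G x₀ r ≤ G.degree x :=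
  Nat.sInf_le ⟨x, hx, rfl⟩

theorem degree_coe_le_degree {V : Type*} (G : SimpleGraph V) [G.LocallyFinite] (H : G.Subgraph)
    [H.coe.LocallyFinite] (x : H.verts) : H.coe.degree x ≤ G.degree (x : V) := by
  refine Finset.card_le_card_of_injOn Subtype.val (fun y hy => ?_) Subtype.val_injective.injOn
  have hy' : H.coe.Adj x y := by simpa using hy
  simpa using H.adj_sub hy'

end StochTree

theorem mainTheorem4 {V : Type*} [Infinite V] (T : SimpleGraph V) [T.LocallyFinite]
    (hT : T.IsTree) :
    (∀ (Tn : T.Subgraph) [Tn.coe.LocallyFinite] (x₀ : Tn.verts) (n : ℕ → ℕ),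
      StochTree.IsModelTree Tn.coe x₀ n →
      (∀ r : ℕ, 0 < r → (n r : ℤ) ≤ (StochTree.minValence T (x₀ : V) r : ℤ) - 1) →
      StochTree.StochasticallyIncomplete Tn.coe →
      StochTree.StochasticallyIncomplete T) ∧
    (∀ x₀ : V,
      (∀ r : ℕ, 1 < StochTree.minValence T x₀ r) →
      Summable (fun r : ℕ => 1 / (StochTree.minValence T x₀ r : ℝ)) →
      StochTree.StochasticallyIncomplete T) := by
  constructor
  · intro Tn _ x₀ n hmodel hn hinc
    obtain ⟨hne, M, hM⟩ := hmodel.ne_zero_and_bounded hinc (c := 1) zero_le_one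
    refine StochTree.stochasticallyIncomplete_of_bounded_radialSolution hT (x₀ : V) hne
      (hmodel.degree_root ▸ StochTree.degree_coe_le_degree T Tn x₀) (fun r hr x hx => ?_)
      one_pos hM
    have h1 := hn r hr
    have h2 := StochTree.minValence_le_degree T hx
    omega
  · intro x₀ hm hsum
    have hsum' : Summable fun r => 1 / ((StochTree.minValence T x₀ r - 1 : ℕ) : ℝ) := by
      refine (hsum.mul_left 2).of_nonneg_of_le (fun r => by positivity) fun r => ?_
      have h2 : (2 : ℝ) ≤ StochTree.minValence T x₀ r := by exact_mod_cast hm r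
      rw [Nat.cast_pred (by have := hm r; omega), mul_one_div,
        div_le_div_iff₀ (by linarith) (by linarith)]
      linarith
    refine StochTree.stochasticallyIncomplete_of_bounded_radialSolution hT x₀
      (n := fun r => StochTree.minValence T x₀ r - 1) (fun r => ?_) ?_ (fun r _ x hx => ?_)
      one_pos (StochTree.radialSolution_le_exp_tsum zero_le_one hsum')
    · have := hm r
      omega
    · have := StochTree.minValence_le_degree T (T.dist_self (v := x₀))
      omega
    · have h1 := hm r
      have h2 := StochTree.minValence_le_degree T hx
      omega
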